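/- Let $n,d\in\mathbb{N}$, let $\mathcal{W}(1),\dots,\mathcal{W}(n)\in\mathbb{C}^{d\times d}$ be quantum states (positive semidefinite matrices of trace $1$), and let $\alpha\in[1/2,1]$. For a Hermitian matrix $X=\sum_i\lambda_i u_iu_i^*$ (eigendecomposition) put $X^r:=\sum_i\lambda_i^r u_iu_i^*$. Let $\Delta_n=\{p\in\mathbb{R}^n: p[j]\ge 0\ \forall j,\ \sum_j p[j]=1\}$ and $$\tilde g_\alpha(p):=\mathrm{Tr}\Big[\Big(\sum_{j=1}^n p[j]\,\mathcal{W}(j)^\alpha\Big)^{1/\alpha}\Big].$$ (So that $\tilde g_\alpha$ is defined on all of $\mathbb{R}^n$, in particular near the boundary points of $\Delta_n$, the power of a negative eigenvalue is understood as $x^r:=|x|^r\cos(\pi r)$ for $x<0$. On the nonnegative orthant $\{p\ge 0\}$ no such power occurs, and since the gradient at a point of $\Delta_n$ is determined by the values on the orthant, it does not depend on this convention.) Then $\tilde g_\alpha$ is $\big(\tfrac{1-\alpha}{\alpha},\tfrac1\alpha\big)$-Hölder smooth on the convex set $\Delta_n$ with respect to $\|\cdot\|_1$; that is, $\tfrac{1-\alpha}{\alpha}\in[0,1]$,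 $\tfrac1\alpha>0$, the function $\tilde g_\alpha$ is differentiable at every point of $\Delta_n$, and, the dual norm of $\|\cdot\|_1$ being $\|\cdot\|_\infty$, $$\big\|\nabla\tilde g_\alpha(p_1)-\nabla\tilde g_\alpha(p_2)\big\|_\infty\le\frac1\alpha\,\|p_1-p_2\|_1^{\,1/\alpha-1}\qquad\text{for all }p_1,p_2\in\Delta_n ,$$ with the convention $0^0=1$ when $\alpha=1$. -/

import Mathlib

open scoped ComplexOrder

noncomputable section

/-- Quantum states in `ℂ^{d × d}`: positive semidefinite matrices of unit trace. -/
def IsQuantumState {d : ℕ} (X : Matrix (Fin d) (Fin d) ℂ) : Prop :=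
  X.PosSemidef ∧ X.trace = 1

/-- The real power `X ^ r` of a Hermitian matrix `X = ∑ λᵢ uᵢ uᵢ*`, that is `∑ λᵢ ^ r uᵢ uᵢ*`. -/
def hermitianPow {d : ℕ} (X : Matrix (Fin d) (Fin d) ℂ) (r : ℝ) : Matrix (Fin d) (Fin d) ℂ :=
  cfc (fun x : ℝ => x ^ r) X

/-- `ℝⁿ` with the norm `‖x‖₁ = ∑ |x j|`. -/
abbrev EllOne (n : ℕ) : Type := PiLp 1 (fun _ : Fin n => ℝ)

/-- The probability simplex `Δₙ` in `ℝⁿ`. -/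
def probSimplex (n : ℕ) : Set (EllOne n) :=
  {p | (∀ j, 0 ≤ p j) ∧ ∑ j, p j = 1}

/-- The exponentiated negative Petz-Rényi information
`p ↦ Tr[(∑ j, p[j] W(j)^α)^(1/α)]`. The matrix under the trace is Hermitian for every real vector
`p`, so the trace is real. On the nonnegative orthant only powers of nonnegative reals occur. -/
def expRenyi {n d : ℕ} (W : Fin n → Matrix (Fin d) (Fin d) ℂ) (α : ℝ) (p : EllOne n) : ℝ :=
  (hermitianPow (∑ j, ((p j : ℝ) : ℂ) • hermitianPow (W j) α) (1 / α)).trace.re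

/-- `(ν, L)`-Hölder smoothness on the convex set `C` with respect to the norm of `E`. The derivative
is taken in the whole space, and its operator norm is the dual norm of the gradient. -/
def HolderSmoothOn {E : Type*} [NormedAddCommGroup E] [NormedSpace ℝ E]
    (f : E → ℝ) (C : Set E) (ν L : ℝ) : Prop :=
  Convex ℝ C ∧ 0 ≤ ν ∧ ν ≤ 1 ∧ 0 < L ∧
    (∀ x ∈ C, DifferentiableAt ℝ f x) ∧
    ∀ x ∈ C, ∀ y ∈ C, ‖fderiv ℝ f x - fderiv ℝ f y‖ ≤ L * ‖x - y‖ ^ ν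

/-- The gradient vector, whose `j`-th coordinate is the `j`-th partial derivative. Its norm as an
element of `Fin n → ℝ` is the `ℓ∞` norm. -/
def gradVec {n : ℕ} (f : EllOne n → ℝ) (x : EllOne n) : Fin n → ℝ :=
  fun j => fderiv ℝ f x (WithLp.toLp 1 (Pi.single j 1))

end

/-! Put `r = 1 / α ∈ [1, 2]`, `A j = W(j)^α` and `X(p) = ∑ p j A j`. The gradient of `Tr X(p)^r` has
coordinates `r Tr (X(p)^(r-1) A i)`, so with `θ = r - 1` the claim reduces to `Tr ((X^θ - Y^θ) A i)
≤ ‖p - q‖₁^θ` for `X = X(p)`, `Y = X(q)`; the absolute value follows by exchanging `p` and `q`.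

Let `c` be the positive part of `p - q` and `B = ∑ c j A j`, so that `X ≤ Y + B`. The core is
`trace_rpow_sub_mul_le`: with decreasingly ordered eigenvalues `b` of `B` and `a` of `A i`, the left
side is at most `∑ b j ^ θ * a j`. For `θ < 1`, an integral representation of `s^θ` reduces this to
resolvents. There `quadForm_rpowIntegrand_sub_le` compares eigenvalues by a min-max argument, and
von Neumann's trace inequality gives the sum. Hölder's inequality with exponents `r / (r - 1)` and
`r` concludes: `∑ a j ^ r = Tr W(i) = 1`, and `∑ b j ^ r ≤ (∑ c j)^r` is the triangle inequality for
the Schatten `r`-norm (`sum_rpow_eigenvalues_le`).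

Differentiability needs no positivity. Weighting scalar Taylor remainders by the overlaps of two
eigenbases gives the first-order expansion of `Tr N^r` at any Hermitian matrix. -/

/-! ### Diagonalization and overlaps of eigenbases -/

/-- The unitary `U` diagonalizes `M` with eigenvalues `m`, compatibly with functional calculus. -/
structure Diagonalizes {d : ℕ} (M U : Matrix (Fin d) (Fin d) ℂ) (m : Fin d → ℝ) : Prop where
  star_mul_self : star U * U = 1
  mul_star_self : U * star U = 1
  cfc_eq : ∀ f : ℝ → ℝ, cfc f M = U * Matrix.diagonal (fun i => (f (m i) : ℂ)) * star U
  isHermitian : M.IsHermitian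

/-- The real quadratic form `v ↦ Re ⟨v, M v⟩`. -/
noncomputable def quadForm {d : ℕ} (M : Matrix (Fin d) (Fin d) ℂ) (v : Fin d → ℂ) : ℝ :=
  (star v ⬝ᵥ M.mulVec v).re

/-- Squared moduli of the inner products of the columns of two matrices. -/
noncomputable def overlap {d : ℕ} (U V : Matrix (Fin d) (Fin d) ℂ) : Matrix (Fin d) (Fin d) ℝ :=
  fun i k => Complex.normSq ((star U * V) i k)

namespace Diagonalizes

variable {d : ℕ} {M N U V : Matrix (Fin d) (Fin d) ℂ} {m l : Fin d → ℝ}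

theorem trace_cfc (h : Diagonalizes M U m) (f : ℝ → ℝ) :
    (cfc f M).trace.re = ∑ i, f (m i) := by
  rw [h.cfc_eq, Matrix.trace_mul_comm, ← mul_assoc, h.star_mul_self, one_mul]
  simp [Matrix.trace]

theorem sum_normSq (h : Diagonalizes M U m) (v : Fin d → ℂ) :
    ∑ i, Complex.normSq ((star U).mulVec v i) = ∑ i, Complex.normSq (v i) := by
  have key : ∀ w : Fin d → ℂ, ((∑ i, Complex.normSq (w i) : ℝ) : ℂ) = star w ⬝ᵥ w := by
    intro w
    push_cast
    refine Finset.sum_congr rfl fun i _ => ?_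
    rw [← Complex.mul_conj, mul_comm]; rfl
  have : ((∑ i, Complex.normSq ((star U).mulVec v i) : ℝ) : ℂ) =
      ((∑ i, Complex.normSq (v i) : ℝ) : ℂ) := by
    rw [key, key, Matrix.star_mulVec, Matrix.dotProduct_mulVec, Matrix.vecMul_vecMul,
      Matrix.star_eq_conjTranspose, Matrix.conjTranspose_conjTranspose,
      ← Matrix.star_eq_conjTranspose, h.mul_star_self, Matrix.vecMul_one]
  exact_mod_cast this

theorem quadForm_cfc (h : Diagonalizes M U m) (f : ℝ → ℝ) (v : Fin d → ℂ) :
    quadForm (cfc f M) v = ∑ i, f (m i) * Complex.normSq ((star U).mulVec v i) := by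
  unfold quadForm
  rw [h.cfc_eq, ← Matrix.mulVec_mulVec, ← Matrix.mulVec_mulVec, Matrix.dotProduct_mulVec]
  have : Matrix.vecMul (star v) U = star ((star U).mulVec v) := by
    rw [Matrix.star_mulVec, Matrix.star_eq_conjTranspose, Matrix.conjTranspose_conjTranspose]
  rw [this, dotProduct, Complex.re_sum]
  refine Finset.sum_congr rfl fun i _ => ?_
  rw [Matrix.mulVec_diagonal, Pi.star_apply, Complex.normSq_apply]
  simp
  ring

theorem quadForm_eq (h : Diagonalizes M U m) (v : Fin d → ℂ) :
    quadForm M v = ∑ i, m i * Complex.normSq ((star U).mulVec v i) := by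
  have := h.quadForm_cfc id v
  rwa [cfc_id ℝ M h.isHermitian.isSelfAdjoint] at this

theorem overlap_mem (h : Diagonalizes M U m) (h' : Diagonalizes N V l) :
    overlap U V ∈ doublyStochastic ℝ (Fin d) := by
  have h1 : (star U * V) * star (star U * V) = 1 := by
    rw [star_mul, star_star, mul_assoc, ← mul_assoc V, h'.mul_star_self, one_mul, h.star_mul_self]
  have h2 : star (star U * V) * (star U * V) = 1 := by
    rw [star_mul, star_star, mul_assoc, ← mul_assoc U, h.mul_star_self, one_mul, h'.star_mul_self]
  rw [mem_doublyStochastic_iff_sum]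
  refine ⟨fun i k => Complex.normSq_nonneg _, fun i => ?_, fun i => ?_⟩
  · have := congrFun (congrFun h1 i) i
    rw [Matrix.mul_apply, Matrix.one_apply_eq] at this
    have := congrArg Complex.re this
    simpa [overlap, Complex.normSq_apply, Matrix.star_apply] using this
  · have := congrFun (congrFun h2 i) i
    rw [Matrix.mul_apply, Matrix.one_apply_eq] at this
    have := congrArg Complex.re this
    simpa [overlap, Complex.normSq_apply, Matrix.star_apply] using this

theorem trace_cfc_mul_cfc (h : Diagonalizes M U m) (h' : Diagonalizes N V l) (f g : ℝ → ℝ) :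
    (cfc f M * cfc g N).trace.re = ∑ i, ∑ k, f (m i) * g (l k) * overlap U V i k := by
  have : (cfc f M * cfc g N).trace =
      (Matrix.diagonal (fun i => (f (m i) : ℂ)) * (star U * V) *
        Matrix.diagonal (fun i => (g (l i) : ℂ)) * star (star U * V)).trace := by
    rw [h.cfc_eq, h'.cfc_eq, star_mul, star_star]
    rw [mul_assoc, mul_assoc, Matrix.trace_mul_comm]
    simp only [mul_assoc]
  rw [this, Matrix.trace, Complex.re_sum]
  refine Finset.sum_congr rfl fun i _ => ?_
  rw [Matrix.diag_apply, Matrix.mul_apply, Complex.re_sum]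
  refine Finset.sum_congr rfl fun k _ => ?_
  rw [Matrix.mul_diagonal, Matrix.diagonal_mul, Matrix.star_apply, overlap, Complex.normSq_apply]
  simp
  ring

theorem nonneg (h : Diagonalizes M U m) (hM : M.PosSemidef) (i : Fin d) : 0 ≤ m i := by
  have h1 := (Complex.le_def.1 (hM.dotProduct_mulVec_nonneg (U.mulVec (Pi.single i 1)))).1
  change 0 ≤ quadForm M _ at h1
  rw [h.quadForm_eq, Matrix.mulVec_mulVec, h.star_mul_self, Matrix.one_mulVec,
    Finset.sum_eq_single i] at h1
  · simpa using h1
  · intro k _ hk; simp [hk]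
  · simp

end Diagonalizes

theorem Matrix.IsHermitian.exists_diagonalizes {d : ℕ} {M : Matrix (Fin d) (Fin d) ℂ}
    (hM : M.IsHermitian) : ∃ U m, Diagonalizes M U m ∧ Antitone m := by
  let e : Fin d ≃ Fin d := Tuple.sort (fun i => - hM.eigenvalues i)
  let U : Matrix (Fin d) (Fin d) ℂ := hM.eigenvectorUnitary
  have hU1 : star U * U = 1 := Unitary.coe_star_mul_self hM.eigenvectorUnitary
  have hU2 : U * star U = 1 := Unitary.coe_mul_star_self hM.eigenvectorUnitary
  refine ⟨U.submatrix id e, hM.eigenvalues ∘ e, ⟨?_, ?_, fun f => ?_, hM⟩, ?_⟩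
  · have : star (U.submatrix id e) * U.submatrix id e = (star U * U).submatrix e e := by
      ext i j; simp [Matrix.mul_apply, Matrix.star_apply]
    rw [this, hU1, Matrix.submatrix_one_equiv]
  · have : U.submatrix id e * star (U.submatrix id e) = U * star U := by
      ext i j
      simp only [Matrix.mul_apply, Matrix.star_apply, Matrix.submatrix_apply, id]
      exact e.sum_comp (fun k => U i k * star (U j k))
    rw [this, hU2]
  · rw [hM.cfc_eq, Matrix.IsHermitian.cfc, Unitary.conjStarAlgAut_apply]
    ext i j
    simp only [Matrix.mul_apply (N := star _), Matrix.mul_diagonal]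
    exact (e.sum_comp (fun k => U i k * (f (hM.eigenvalues k) : ℂ) * star U k j)).symm
  · intro i j hij
    have := Tuple.monotone_sort (fun i => - hM.eigenvalues i) hij
    simpa [e] using this

theorem isHermitian_cfc {d : ℕ} (f : ℝ → ℝ) (M : Matrix (Fin d) (Fin d) ℂ) :
    (cfc f M).IsHermitian := cfc_predicate f M

/-! ### Min-max bounds and von Neumann's trace inequality -/

section
variable {d : ℕ} {M N U V : Matrix (Fin d) (Fin d) ℂ} {m l : Fin d → ℝ}

/-- An upper bound for the `j`-th largest eigenvalue from a bound on the quadratic form on the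
common kernel of `j` linear functionals. -/
theorem Diagonalizes.eigenvalue_le (h : Diagonalizes M U m) (hm : Antitone m) (j : Fin d) (c : ℝ)
    (φ : Fin d → (Fin d → ℂ) →ₗ[ℂ] ℂ)
    (hφ : ∀ v, (∀ i < j, φ i v = 0) → quadForm M v ≤ c * ∑ i, Complex.normSq (v i)) :
    m j ≤ c := by
  -- Dimension count: the `j`-th output of `L` is zero, so `L` is not surjective, hence not
  -- injective. A nonzero kernel vector `y` gives `U y` in the span of the eigenvectors up to `j`,
  -- where the form is at least `m j` times the squared norm, and in the common kernel of the `φ i`.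
  let L : (Fin d → ℂ) →ₗ[ℂ] (Fin d → ℂ) := LinearMap.pi fun i =>
    if i < j then φ i ∘ₗ U.mulVecLin else if j < i then LinearMap.proj i else 0
  have hL : ¬ Function.Injective L := by
    rw [LinearMap.injective_iff_surjective]
    intro hs
    obtain ⟨y, hy⟩ := hs (Pi.single j 1)
    have := congrFun hy j
    simp [L] at this
  obtain ⟨y, hy, hy0⟩ : ∃ y, L y = 0 ∧ y ≠ 0 := by
    by_contra! hc
    exact hL ((injective_iff_map_eq_zero L).2 hc)
  have hlow : ∀ i < j, φ i (U.mulVec y) = 0 := fun i hi => by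
    have := congrFun hy i
    simpa [L, hi] using this
  have hhigh : ∀ i, j < i → y i = 0 := fun i hi => by
    have := congrFun hy i
    simpa [L, hi, hi.le, not_lt.2 hi.le] using this
  have h1 := hφ _ hlow
  rw [← h.sum_normSq, h.quadForm_eq, Matrix.mulVec_mulVec, h.star_mul_self,
    Matrix.one_mulVec] at h1
  have h2 : m j * ∑ i, Complex.normSq (y i) ≤ ∑ i, m i * Complex.normSq (y i) := by
    rw [Finset.mul_sum]
    refine Finset.sum_le_sum fun i _ => ?_
    rcases le_or_gt i j with hi | hi
    · exact mul_le_mul_of_nonneg_right (hm hi) (Complex.normSq_nonneg _)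
    · simp [hhigh i hi]
  have h3 : 0 < ∑ i, Complex.normSq (y i) := by
    obtain ⟨k, hk⟩ := Function.ne_iff.1 hy0
    exact Finset.sum_pos' (fun i _ => Complex.normSq_nonneg _)
      ⟨k, Finset.mem_univ _, Complex.normSq_pos.2 hk⟩
  exact le_of_mul_le_mul_right (h2.trans h1) h3

/-- By Birkhoff's theorem `S` is a convex combination of permutation matrices; for each permutation
this is the rearrangement inequality. -/
theorem sum_mul_doublyStochastic_le {δ a : Fin d → ℝ} (hδ : Antitone δ) (ha : Antitone a)
    {S : Matrix (Fin d) (Fin d) ℝ} (hS : S ∈ doublyStochastic ℝ (Fin d)) :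
    ∑ i, ∑ k, δ i * a k * S i k ≤ ∑ i, δ i * a i := by
  obtain ⟨w, hw0, hw1, rfl⟩ := exists_eq_sum_perm_of_mem_doublyStochastic hS
  have h1 : ∀ i k, δ i * a k * (∑ σ : Equiv.Perm (Fin d), w σ • σ.permMatrix ℝ) i k =
      ∑ σ : Equiv.Perm (Fin d), w σ * (if σ i = k then δ i * a k else 0) := by
    intro i k
    rw [Matrix.sum_apply, Finset.mul_sum]
    refine Finset.sum_congr rfl fun σ _ => ?_
    simp [Equiv.Perm.permMatrix, PEquiv.toMatrix_apply, Equiv.toPEquiv_apply]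
    split_ifs <;> ring
  have h2 : ∑ i, ∑ k, δ i * a k * (∑ σ : Equiv.Perm (Fin d), w σ • σ.permMatrix ℝ) i k =
      ∑ σ : Equiv.Perm (Fin d), w σ * ∑ i, δ i * a (σ i) := by
    simp_rw [h1, Finset.mul_sum]
    simp_rw [Finset.sum_comm (s := (Finset.univ : Finset (Fin d)))
      (t := (Finset.univ : Finset (Equiv.Perm (Fin d))))]
    refine Finset.sum_congr rfl fun σ _ => Finset.sum_congr rfl fun i _ => ?_
    simp
  rw [h2]
  calc ∑ σ : Equiv.Perm (Fin d), w σ * ∑ i, δ i * a (σ i)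
      ≤ ∑ σ : Equiv.Perm (Fin d), w σ * ∑ i, δ i * a i := by
        refine Finset.sum_le_sum fun σ _ => mul_le_mul_of_nonneg_left ?_ (hw0 σ)
        exact (hδ.monovary ha).sum_mul_comp_perm_le_sum_mul
    _ = ∑ i, δ i * a i := by rw [← Finset.sum_mul, hw1, one_mul]

/-- A form of the von Neumann trace inequality. -/
theorem Diagonalizes.trace_mul_le {A D : Matrix (Fin d) (Fin d) ℂ} {a c : Fin d → ℝ}
    (hA : Diagonalizes A V a) (ha : Antitone a) (ha0 : ∀ i, 0 ≤ a i) (hD : D.IsHermitian)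
    (hc : ∀ j, ∃ φ : Fin d → (Fin d → ℂ) →ₗ[ℂ] ℂ,
      ∀ v, (∀ i < j, φ i v = 0) → quadForm D v ≤ c j * ∑ i, Complex.normSq (v i)) :
    (D * A).trace.re ≤ ∑ j, c j * a j := by
  obtain ⟨U, δ, hU, hδ⟩ := hD.exists_diagonalizes
  have h1 := hU.trace_cfc_mul_cfc hA id id
  rw [cfc_id ℝ D hD.isSelfAdjoint, cfc_id ℝ A hA.isHermitian.isSelfAdjoint] at h1
  rw [h1]
  refine (sum_mul_doublyStochastic_le hδ ha (hU.overlap_mem hA)).trans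
    (Finset.sum_le_sum fun j _ => mul_le_mul_of_nonneg_right ?_ (ha0 j))
  obtain ⟨φ, hφ⟩ := hc j
  exact hU.eigenvalue_le hδ j (c j) φ hφ

/-- The `i`-th coordinate with respect to the columns of `U`, after applying `N`. -/
noncomputable def coordFunctional (U N : Matrix (Fin d) (Fin d) ℂ) (i : Fin d) :
    (Fin d → ℂ) →ₗ[ℂ] ℂ :=
  LinearMap.proj i ∘ₗ (star U).mulVecLin ∘ₗ N.mulVecLin

theorem coordFunctional_apply (U N : Matrix (Fin d) (Fin d) ℂ) (i : Fin d) (v : Fin d → ℂ) :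
    coordFunctional U N i v = (star U).mulVec (N.mulVec v) i := rfl

theorem Diagonalizes.quadForm_le_of_coord (h : Diagonalizes M U m) (hm : Antitone m) (j : Fin d)
    (v : Fin d → ℂ) (hv : ∀ i < j, (star U).mulVec v i = 0) :
    quadForm M v ≤ m j * ∑ i, Complex.normSq (v i) := by
  rw [h.quadForm_eq, ← h.sum_normSq, Finset.mul_sum]
  refine Finset.sum_le_sum fun i _ => ?_
  rcases lt_or_ge i j with hi | hi
  · simp [hv i hi]
  · exact mul_le_mul_of_nonneg_right (hm hi) (Complex.normSq_nonneg _)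

theorem quadForm_sub (v : Fin d → ℂ) : quadForm (M - N) v = quadForm M v - quadForm N v := by
  simp [quadForm, Matrix.sub_mulVec]

end

/-! ### Resolvent comparison and its integration to fractional powers -/

/-- Completing the square linearizes the resolvent: `(t + x)⁻¹ |z|²` is the maximum over `w` of `2
Re (z̄ w) - (x + t) |w|²`. The resulting bound is affine in `x`, so its matrix form can use an
operator inequality on `X`. -/
theorem rpowIntegrand_mul_normSq_le {θ t x : ℝ} (ht : 0 < t) (hx : 0 ≤ x) (z w : ℂ) :
    Real.rpowIntegrand₀₁ θ t x * Complex.normSq z ≤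
      t ^ θ * (t⁻¹ * Complex.normSq z - 2 * (star z * w).re + (x + t) * Complex.normSq w) := by
  unfold Real.rpowIntegrand₀₁
  rw [mul_assoc]
  refine mul_le_mul_of_nonneg_left ?_ (by positivity)
  have hs : 0 < t + x := by positivity
  have key : 0 ≤ (t + x)⁻¹ * Complex.normSq (z - ((t + x : ℝ) : ℂ) * w) :=
    mul_nonneg (by positivity) (Complex.normSq_nonneg _)
  have : (t + x)⁻¹ * Complex.normSq (z - ((t + x : ℝ) : ℂ) * w) =
      (t + x)⁻¹ * Complex.normSq z - 2 * (star z * w).re + (x + t) * Complex.normSq w := by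
    simp only [Complex.normSq_apply, Complex.sub_re, Complex.sub_im, Complex.mul_re, Complex.mul_im,
      Complex.ofReal_re, Complex.ofReal_im, Complex.star_def, Complex.conj_re, Complex.conj_im]
    field_simp
    ring
  rw [this] at key
  nlinarith [key]

section
variable {d : ℕ} {X Y B P Q A V : Matrix (Fin d) (Fin d) ℂ} {x y b a : Fin d → ℝ}

theorem Diagonalizes.re_dotProduct (h : Diagonalizes X P x) (v w : Fin d → ℂ) :
    (star v ⬝ᵥ w).re = ∑ i, (star ((star P).mulVec v i) * (star P).mulVec w i).re := by
  have : star v ⬝ᵥ w = star ((star P).mulVec v) ⬝ᵥ (star P).mulVec w := by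
    rw [Matrix.star_mulVec, Matrix.dotProduct_mulVec, Matrix.vecMul_vecMul,
      Matrix.star_eq_conjTranspose, Matrix.conjTranspose_conjTranspose,
      ← Matrix.star_eq_conjTranspose, h.mul_star_self, Matrix.vecMul_one]
  rw [this, dotProduct, Complex.re_sum]
  rfl

theorem Diagonalizes.quadForm_rpowIntegrand_le (h : Diagonalizes X P x) (hx : ∀ i, 0 ≤ x i)
    {θ t : ℝ} (ht : 0 < t) (v w : Fin d → ℂ) :
    quadForm (cfc (Real.rpowIntegrand₀₁ θ t) X) v ≤
      t ^ θ * (t⁻¹ * ∑ i, Complex.normSq (v i) - 2 * (star v ⬝ᵥ w).re + quadForm X w +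
        t * ∑ i, Complex.normSq (w i)) := by
  rw [h.quadForm_cfc, h.quadForm_eq, h.re_dotProduct, ← h.sum_normSq v, ← h.sum_normSq w]
  simp only [Finset.mul_sum, ← Finset.sum_sub_distrib, ← Finset.sum_add_distrib]
  refine Finset.sum_le_sum fun i _ =>
    (rpowIntegrand_mul_normSq_le ht (hx i) _ ((star P).mulVec w i)).trans_eq ?_
  ring

/-- Subadditivity of the integrand in its last argument, written as an increment bound. -/
theorem rpowIntegrand_sub_le {θ t β : ℝ} (ht : 0 < t) (hβ : 0 ≤ β) {η : ℝ} (hη : 0 ≤ η) :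
    t ^ θ * (t⁻¹ - (t + η + β)⁻¹) - Real.rpowIntegrand₀₁ θ t η ≤ Real.rpowIntegrand₀₁ θ t β := by
  unfold Real.rpowIntegrand₀₁
  rw [← mul_sub]
  refine mul_le_mul_of_nonneg_left ?_ (by positivity)
  have h1 : (t + η)⁻¹ - (t + η + β)⁻¹ = β / ((t + η) * (t + η + β)) := by
    have : t + η ≠ 0 := by positivity
    have : t + η + β ≠ 0 := by positivity
    field_simp; ring
  have h2 : t⁻¹ - (t + β)⁻¹ = β / (t * (t + β)) := by
    have : t + β ≠ 0 := by positivity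
    field_simp; ring
  have h3 : β / ((t + η) * (t + η + β)) ≤ β / (t * (t + β)) := by
    gcongr <;> linarith
  linarith

/-- The test vector `w = (t + Y + b j)⁻¹ v` is optimal for `Y + b j` in place of `X`. The conditions
on `v` make `w` orthogonal to the first `j` eigenvectors of `B`, so on `w` the form of `B` is at
most `b j`; subadditivity of the integrand then removes `Y`. -/
theorem quadForm_rpowIntegrand_sub_le (hX : X.PosSemidef) (hY : Y.PosSemidef)
    (hXY : ∀ v, quadForm X v ≤ quadForm Y v + quadForm B v) (hB : Diagonalizes B Q b)
    (hb : Antitone b) (hb0 : ∀ i, 0 ≤ b i) {θ t : ℝ} (ht : 0 < t) (j : Fin d) :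
    ∃ φ : Fin d → (Fin d → ℂ) →ₗ[ℂ] ℂ, ∀ v, (∀ i < j, φ i v = 0) →
      quadForm (cfc (Real.rpowIntegrand₀₁ θ t) X - cfc (Real.rpowIntegrand₀₁ θ t) Y) v ≤
        Real.rpowIntegrand₀₁ θ t (b j) * ∑ i, Complex.normSq (v i) := by
  obtain ⟨P, x, hP, -⟩ := hX.isHermitian.exists_diagonalizes
  obtain ⟨R, y, hR, -⟩ := hY.isHermitian.exists_diagonalizes
  have hx := hP.nonneg hX
  have hy := hR.nonneg hY
  set G := cfc (fun η => (t + η + b j)⁻¹) Y with hG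
  refine ⟨coordFunctional Q G, fun v hv => ?_⟩
  set w := G.mulVec v with hw
  have hcoord : ∀ i, (star R).mulVec w i = ((t + y i + b j)⁻¹ : ℝ) * (star R).mulVec v i := by
    intro i
    rw [hw, hG, hR.cfc_eq, Matrix.mulVec_mulVec, ← mul_assoc, ← mul_assoc, hR.star_mul_self,
      one_mul, ← Matrix.mulVec_mulVec, Matrix.mulVec_diagonal]
  have h1 := hP.quadForm_rpowIntegrand_le (θ := θ) hx ht v w
  have h2 := hB.quadForm_le_of_coord hb j w hv
  have h3 : t⁻¹ * ∑ i, Complex.normSq (v i) - 2 * (star v ⬝ᵥ w).re + quadForm X w +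
        t * ∑ i, Complex.normSq (w i) ≤ t⁻¹ * ∑ i, Complex.normSq (v i) - 2 * (star v ⬝ᵥ w).re +
        (quadForm Y w + b j * ∑ i, Complex.normSq (w i)) + t * ∑ i, Complex.normSq (w i) := by
    linarith [hXY w]
  have h4 : t⁻¹ * ∑ i, Complex.normSq (v i) - 2 * (star v ⬝ᵥ w).re +
        (quadForm Y w + b j * ∑ i, Complex.normSq (w i)) + t * ∑ i, Complex.normSq (w i) =
        ∑ i, (t⁻¹ - (t + y i + b j)⁻¹) * Complex.normSq ((star R).mulVec v i) := by
    rw [hR.quadForm_eq, hR.re_dotProduct, ← hR.sum_normSq v, ← hR.sum_normSq w]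
    simp only [Finset.mul_sum, ← Finset.sum_sub_distrib, ← Finset.sum_add_distrib]
    refine Finset.sum_congr rfl fun i _ => ?_
    have hne : t + y i + b j ≠ 0 := by linarith [hy i, hb0 j]
    rw [hcoord]
    simp only [Complex.normSq_apply, Complex.mul_re, Complex.mul_im,
      Complex.ofReal_re, Complex.ofReal_im, Complex.star_def, Complex.conj_re, Complex.conj_im]
    field_simp
    ring
  have h5 := h1.trans (mul_le_mul_of_nonneg_left (h3.trans_eq h4) (by positivity : 0 ≤ t ^ θ))
  rw [quadForm_sub, hR.quadForm_cfc, ← hR.sum_normSq v]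
  rw [Finset.mul_sum] at h5 ⊢
  calc _ ≤ _ := sub_le_sub_right h5 _
    _ ≤ _ := by
      rw [← Finset.sum_sub_distrib]
      refine Finset.sum_le_sum fun i _ => ?_
      rw [← mul_assoc, ← sub_mul]
      exact mul_le_mul_of_nonneg_right (rpowIntegrand_sub_le ht (hb0 j) (hy i))
        (Complex.normSq_nonneg _)

theorem trace_rpow_sub_mul_le (hX : X.PosSemidef) (hY : Y.PosSemidef)
    (hXY : ∀ v, quadForm X v ≤ quadForm Y v + quadForm B v) (hB : Diagonalizes B Q b)
    (hb : Antitone b) (hb0 : ∀ i, 0 ≤ b i) (hA : Diagonalizes A V a) (ha : Antitone a)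
    (ha0 : ∀ i, 0 ≤ a i) {θ : ℝ} (hθ0 : 0 < θ) (hθ1 : θ ≤ 1) :
    (cfc (fun s : ℝ => s ^ θ) X * A).trace.re - (cfc (fun s : ℝ => s ^ θ) Y * A).trace.re ≤
      ∑ j, b j ^ θ * a j := by
  -- The integral representation requires `θ < 1`; for `θ = 1` the difference is `X - Y` itself.
  rcases hθ1.eq_or_lt with rfl | hθ1
  · simp only [Real.rpow_one]
    rw [← Complex.sub_re, ← Matrix.trace_sub, ← sub_mul]
    refine hA.trace_mul_le ha ha0 ((isHermitian_cfc _ _).sub (isHermitian_cfc _ _)) fun j =>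
      ⟨coordFunctional Q 1, fun v hv => ?_⟩
    rw [cfc_id' ℝ X hX.isHermitian.isSelfAdjoint, cfc_id' ℝ Y hY.isHermitian.isSelfAdjoint,
      quadForm_sub]
    have h2 := hB.quadForm_le_of_coord hb j v fun i hi => by
      simpa [coordFunctional_apply] using hv i hi
    linarith [hXY v]
  · obtain ⟨μ, hμ⟩ := Real.exists_measure_rpow_eq_integral_rpowIntegrand₀₁
      (p := θ) ⟨hθ0, hθ1⟩
    have hint := fun s hs => (hμ s hs).1
    have heq := fun s hs => (hμ s hs).2
    have htr : ∀ {Z : Matrix (Fin d) (Fin d) ℂ}, Z.PosSemidef →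
        MeasureTheory.IntegrableOn
          (fun t => (cfc (Real.rpowIntegrand₀₁ θ t) Z * A).trace.re) (Set.Ioi 0) μ ∧
        (cfc (fun s : ℝ => s ^ θ) Z * A).trace.re =
          ∫ t in Set.Ioi 0, (cfc (Real.rpowIntegrand₀₁ θ t) Z * A).trace.re ∂μ := by
      intro Z hZ
      obtain ⟨P, z, hP, -⟩ := hZ.isHermitian.exists_diagonalizes
      have hz := hP.nonneg hZ
      have h1 : ∀ f : ℝ → ℝ, (cfc f Z * A).trace.re =
          ∑ i, ∑ k, f (z i) * (a k * overlap P V i k) := by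
        intro f
        have := hP.trace_cfc_mul_cfc hA f id
        rw [cfc_id ℝ A hA.isHermitian.isSelfAdjoint] at this
        simpa [mul_assoc] using this
      have hint' : ∀ i k, MeasureTheory.IntegrableOn
          (fun t => Real.rpowIntegrand₀₁ θ t (z i) * (a k * overlap P V i k)) (Set.Ioi 0) μ :=
        fun i k => (hint _ (hz i)).mul_const _
      simp only [h1]
      refine ⟨MeasureTheory.integrable_finsetSum _ fun i _ =>
        MeasureTheory.integrable_finsetSum _ fun k _ => hint' i k, ?_⟩
      rw [MeasureTheory.integral_finsetSum _ fun i _ =>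
        MeasureTheory.integrable_finsetSum _ fun k _ => hint' i k]
      refine Finset.sum_congr rfl fun i _ => ?_
      rw [MeasureTheory.integral_finsetSum _ fun k _ => hint' i k]
      refine Finset.sum_congr rfl fun k _ => ?_
      rw [MeasureTheory.integral_mul_const, heq _ (hz i)]
    rw [(htr hX).2, (htr hY).2, ← MeasureTheory.integral_sub (htr hX).1 (htr hY).1]
    have hint' : ∀ j, MeasureTheory.IntegrableOn
        (fun t => Real.rpowIntegrand₀₁ θ t (b j) * a j) (Set.Ioi 0) μ :=
      fun j => (hint _ (hb0 j)).mul_const _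
    have hR : ∑ j, b j ^ θ * a j =
        ∫ t in Set.Ioi 0, ∑ j, Real.rpowIntegrand₀₁ θ t (b j) * a j ∂μ := by
      rw [MeasureTheory.integral_finsetSum _ fun j _ => hint' j]
      refine Finset.sum_congr rfl fun j _ => ?_
      rw [MeasureTheory.integral_mul_const, heq _ (hb0 j)]
    rw [hR]
    refine MeasureTheory.setIntegral_mono_on ((htr hX).1.sub (htr hY).1)
      (MeasureTheory.integrable_finsetSum _ fun j _ => hint' j) measurableSet_Ioi fun t ht => ?_
    rw [← Complex.sub_re, ← Matrix.trace_sub, ← sub_mul]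
    exact hA.trace_mul_le ha ha0 ((isHermitian_cfc _ _).sub (isHermitian_cfc _ _))
      fun j => quadForm_rpowIntegrand_sub_le hX hY hXY hB hb hb0 ht j

end

/-! ### Schatten norms and the Hölder estimate -/

section
variable {d : ℕ} {M N U V X Y B Q A : Matrix (Fin d) (Fin d) ℂ} {m l b a : Fin d → ℝ}

theorem quadForm_smul (c : ℝ) (v : Fin d → ℂ) : quadForm ((c : ℂ) • M) v = c * quadForm M v := by
  simp [quadForm, Matrix.smul_mulVec]

theorem quadForm_sum {ι : Type*} (s : Finset ι) (F : ι → Matrix (Fin d) (Fin d) ℂ)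
    (v : Fin d → ℂ) : quadForm (∑ j ∈ s, F j) v = ∑ j ∈ s, quadForm (F j) v := by
  simp [quadForm, Matrix.sum_mulVec, dotProduct_sum]

theorem Diagonalizes.quadForm_cfc_col (h : Diagonalizes M U m) (f : ℝ → ℝ) (k : Fin d) :
    quadForm (cfc f M) (V.mulVec (Pi.single k 1)) = ∑ i, f (m i) * overlap U V i k := by
  rw [h.quadForm_cfc, Matrix.mulVec_mulVec]
  simp [overlap]

theorem Diagonalizes.overlap_self (h : Diagonalizes M U m) : overlap U U = 1 := by
  ext i k
  rw [overlap, h.star_mul_self, Matrix.one_apply, Matrix.one_apply]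
  split_ifs <;> simp

theorem Matrix.PosSemidef.quadForm_nonneg (hM : M.PosSemidef) (v : Fin d → ℂ) :
    0 ≤ quadForm M v :=
  (Complex.le_def.1 (hM.dotProduct_mulVec_nonneg v)).1

theorem Diagonalizes.posSemidef_cfc (h : Diagonalizes M U m) {f : ℝ → ℝ}
    (hf : ∀ i, 0 ≤ f (m i)) : (cfc f M).PosSemidef := by
  rw [h.cfc_eq]
  refine Matrix.PosSemidef.mul_mul_conjTranspose_same (Matrix.PosSemidef.diagonal fun i => ?_) U
  show (0 : ℂ) ≤ (f (m i) : ℂ)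
  exact_mod_cast hf i

/-- In an eigenbasis of the sum, each `b k` is `∑ c j` times a convex combination of diagonal
entries of the `A j`. Jensen's inequality is used twice: for this combination, and to bound the
`r`-th powers of the diagonal entries of `A j` by those of its eigenvalues. -/
theorem sum_rpow_eigenvalues_le {n : ℕ} {A : Fin n → Matrix (Fin d) (Fin d) ℂ}
    (hA : ∀ j, (A j).PosSemidef) {r : ℝ} (hr : 1 ≤ r)
    (hA1 : ∀ j, (cfc (fun s : ℝ => s ^ r) (A j)).trace.re = 1) {c : Fin n → ℝ}
    (hc : ∀ j, 0 ≤ c j) (hB : Diagonalizes (∑ j, (c j : ℂ) • A j) Q b) :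
    ∑ k, b k ^ r ≤ (∑ j, c j) ^ r := by
  have hbk : ∀ k, b k = ∑ j, c j * quadForm (A j) (Q.mulVec (Pi.single k 1)) := by
    intro k
    have := hB.quadForm_cfc_col (V := Q) id k
    rw [cfc_id ℝ _ hB.isHermitian.isSelfAdjoint, hB.overlap_self, quadForm_sum] at this
    simp only [quadForm_smul] at this
    rw [this]
    simp [Matrix.one_apply]
  set C := ∑ j, c j with hC
  have hC0 : 0 ≤ C := Finset.sum_nonneg fun j _ => hc j
  rcases hC0.eq_or_lt with h0 | hpos
  · have hc0 : ∀ j, c j = 0 := fun j =>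
      (Finset.sum_eq_zero_iff_of_nonneg fun j _ => hc j).1 h0.symm j (Finset.mem_univ j)
    have hr0 : r ≠ 0 := by linarith
    simp [hbk, hc0, ← h0, Real.zero_rpow hr0]
  · have hterm : ∀ k, b k ^ r ≤
        C ^ r * ∑ j, c j / C * quadForm (A j) (Q.mulVec (Pi.single k 1)) ^ r := by
      intro k
      have h1 : b k = C * ∑ j, c j / C * quadForm (A j) (Q.mulVec (Pi.single k 1)) := by
        rw [hbk, Finset.mul_sum]
        refine Finset.sum_congr rfl fun j _ => ?_
        field_simp
      rw [h1, Real.mul_rpow hC0 (Finset.sum_nonneg fun j _ =>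
        mul_nonneg (div_nonneg (hc j) hC0) ((hA j).quadForm_nonneg _))]
      refine mul_le_mul_of_nonneg_left ?_ (Real.rpow_nonneg hC0 r)
      refine Real.rpow_arith_mean_le_arith_mean_rpow _ _ _ (fun j _ => div_nonneg (hc j) hC0) ?_
        (fun j _ => (hA j).quadForm_nonneg _) hr
      rw [← Finset.sum_div, div_self hpos.ne']
    have hcol : ∀ j, ∑ k, quadForm (A j) (Q.mulVec (Pi.single k 1)) ^ r ≤ 1 := by
      intro j
      obtain ⟨V, a, hV, -⟩ := (hA j).isHermitian.exists_diagonalizes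
      have hS := mem_doublyStochastic_iff_sum.1 (hV.overlap_mem hB)
      have h2 : ∀ k, quadForm (A j) (Q.mulVec (Pi.single k 1)) = ∑ i, overlap V Q i k * a i := by
        intro k
        have := hV.quadForm_cfc_col (V := Q) id k
        rw [cfc_id ℝ _ (hA j).isHermitian.isSelfAdjoint] at this
        simpa [mul_comm] using this
      calc ∑ k, quadForm (A j) (Q.mulVec (Pi.single k 1)) ^ r
          ≤ ∑ k, ∑ i, overlap V Q i k * a i ^ r := by
            refine Finset.sum_le_sum fun k _ => ?_
            rw [h2]
            exact Real.rpow_arith_mean_le_arith_mean_rpow _ _ _ (fun i _ => hS.1 i k)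
              (hS.2.2 k) (fun i _ => hV.nonneg (hA j) i) hr
        _ = ∑ i, a i ^ r := by
            rw [Finset.sum_comm]
            refine Finset.sum_congr rfl fun i _ => ?_
            rw [← Finset.sum_mul, hS.2.1 i, one_mul]
        _ = 1 := by rw [← hA1 j, hV.trace_cfc]
    calc ∑ k, b k ^ r
        ≤ ∑ k, C ^ r * ∑ j, c j / C * quadForm (A j) (Q.mulVec (Pi.single k 1)) ^ r :=
          Finset.sum_le_sum fun k _ => hterm k
      _ = C ^ r * ∑ j, c j / C * ∑ k, quadForm (A j) (Q.mulVec (Pi.single k 1)) ^ r := by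
          rw [← Finset.mul_sum, Finset.sum_comm]
          simp_rw [Finset.mul_sum]
      _ ≤ C ^ r * ∑ j, c j / C * 1 := by
          refine mul_le_mul_of_nonneg_left (Finset.sum_le_sum fun j _ =>
            mul_le_mul_of_nonneg_left (hcol j) (div_nonneg (hc j) hC0)) (Real.rpow_nonneg hC0 r)
      _ = C ^ r := by simp_rw [mul_one]; rw [← Finset.sum_div, div_self hpos.ne', mul_one]

theorem posSemidef_sum_smul {n : ℕ} {A : Fin n → Matrix (Fin d) (Fin d) ℂ}
    (hA : ∀ j, (A j).PosSemidef) {c : Fin n → ℝ} (hc : ∀ j, 0 ≤ c j) :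
    (∑ j, (c j : ℂ) • A j).PosSemidef := by
  refine Matrix.posSemidef_sum _ fun j _ => (hA j).smul ?_
  exact_mod_cast hc j

theorem isHermitian_sum_smul {n : ℕ} {A : Fin n → Matrix (Fin d) (Fin d) ℂ}
    (hA : ∀ j, (A j).IsHermitian) (c : Fin n → ℝ) :
    (∑ j, (c j : ℂ) • A j).IsHermitian := by
  unfold Matrix.IsHermitian
  rw [Matrix.conjTranspose_sum]
  refine Finset.sum_congr rfl fun j _ => ?_
  rw [Matrix.conjTranspose_smul, (hA j).eq]
  simp

/-- Hölder continuity of `p ↦ Tr (X(p)^(r-1) A i)` for `X(p) = ∑ p j A j`, one-sided form. -/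
theorem trace_rpow_sub_mul_le_rpow {n : ℕ} {A : Fin n → Matrix (Fin d) (Fin d) ℂ}
    (hA : ∀ j, (A j).PosSemidef) {r : ℝ} (hr : 1 ≤ r) (hr2 : r ≤ 2)
    (hA1 : ∀ j, (cfc (fun s : ℝ => s ^ r) (A j)).trace.re = 1) {p q : Fin n → ℝ}
    (hp : ∀ j, 0 ≤ p j) (hq : ∀ j, 0 ≤ q j) (i : Fin n) :
    (cfc (fun s : ℝ => s ^ (r - 1)) (∑ j, (p j : ℂ) • A j) * A i).trace.re -
      (cfc (fun s : ℝ => s ^ (r - 1)) (∑ j, (q j : ℂ) • A j) * A i).trace.re ≤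
        (∑ j, |p j - q j|) ^ (r - 1) := by
  -- For `r = 1` both powers are the identity and the right side is `1`, even when `p = q`, since `0
  -- ^ 0 = 1`.
  rcases hr.eq_or_lt with rfl | hr1
  · have hX := (posSemidef_sum_smul hA hp).isHermitian.isSelfAdjoint
    have hY := (posSemidef_sum_smul hA hq).isHermitian.isSelfAdjoint
    simp only [sub_self, Real.rpow_zero]
    rw [cfc_const_one ℝ _ hX, cfc_const_one ℝ _ hY, sub_self]
    exact zero_le_one
  · set c : Fin n → ℝ := fun j => max (p j - q j) 0 with hcdef
    have hc : ∀ j, 0 ≤ c j := fun j => le_max_right _ _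
    have hBpos := posSemidef_sum_smul hA hc
    obtain ⟨Q, b, hB, hb⟩ := hBpos.isHermitian.exists_diagonalizes
    have hb0 := hB.nonneg hBpos
    obtain ⟨V, a, hV, ha⟩ := (hA i).isHermitian.exists_diagonalizes
    have ha0 := hV.nonneg (hA i)
    have hsum := sum_rpow_eigenvalues_le hA hr hA1 hc hB
    have ha1 : ∑ k, a k ^ r = 1 := by rw [← hA1 i, hV.trace_cfc]
    have hXY : ∀ v, quadForm (∑ j, (p j : ℂ) • A j) v ≤
        quadForm (∑ j, (q j : ℂ) • A j) v + quadForm (∑ j, (c j : ℂ) • A j) v := by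
      intro v
      simp only [quadForm_sum, quadForm_smul, ← Finset.sum_add_distrib, ← add_mul]
      refine Finset.sum_le_sum fun j _ =>
        mul_le_mul_of_nonneg_right ?_ ((hA j).quadForm_nonneg v)
      have := le_max_left (p j - q j) 0
      simp only [hcdef]
      linarith
    have hC0 : 0 ≤ ∑ j, c j := Finset.sum_nonneg fun j _ => hc j
    have hθ : 0 < r - 1 := by linarith
    have hr0 : 0 < r := by linarith
    have hconj : (r / (r - 1)).HolderConjugate r := by
      rw [Real.holderConjugate_iff]
      refine ⟨by rw [lt_div_iff₀ hθ]; linarith, ?_⟩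
      field_simp
      ring
    refine (trace_rpow_sub_mul_le (posSemidef_sum_smul hA hp) (posSemidef_sum_smul hA hq) hXY hB hb
      hb0 hV ha ha0 hθ (by linarith)).trans ?_
    refine (Real.inner_le_Lp_mul_Lq_of_nonneg _ hconj
      (fun k _ => Real.rpow_nonneg (hb0 k) _) (fun k _ => ha0 k)).trans ?_
    rw [ha1, Real.one_rpow, mul_one]
    have h1 : ∀ k, (b k ^ (r - 1)) ^ (r / (r - 1)) = b k ^ r := by
      intro k
      rw [← Real.rpow_mul (hb0 k)]
      congr 1
      field_simp
    simp only [h1]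
    calc (∑ k, b k ^ r) ^ (1 / (r / (r - 1)))
        ≤ ((∑ j, c j) ^ r) ^ (1 / (r / (r - 1))) :=
          Real.rpow_le_rpow (Finset.sum_nonneg fun k _ => Real.rpow_nonneg (hb0 k) _) hsum
            (by positivity)
      _ = (∑ j, c j) ^ (r - 1) := by
          rw [← Real.rpow_mul hC0]
          congr 1
          field_simp
      _ ≤ (∑ j, |p j - q j|) ^ (r - 1) :=
          Real.rpow_le_rpow hC0 (Finset.sum_le_sum fun j _ => max_le (le_abs_self _) (abs_nonneg _))
            hθ.le

end

/-! ### First-order expansion of the trace of a power -/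

/-- Near `x₀` differentiability gives the `ε` term; away from `x₀` everything is at most quadratic
because `r ≤ 2`. The bound is global in `x`, as nothing restricts which eigenvalues of the two
matrices get paired. -/
theorem abs_rpow_sub_taylor_le {r : ℝ} (hr : 1 ≤ r) (hr2 : r ≤ 2) (x₀ : ℝ) {ε : ℝ} (hε : 0 < ε) :
    ∃ K, 0 ≤ K ∧ ∀ x : ℝ, |x ^ r - x₀ ^ r - r * x₀ ^ (r - 1) * (x - x₀)| ≤
      ε * |x - x₀| + K * (x - x₀) ^ 2 := by
  have hd := (Real.hasDerivAt_rpow_const (x := x₀) (p := r) (Or.inr hr)).isLittleO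
  obtain ⟨δ, hδ, hδ'⟩ := Metric.eventually_nhds_iff.1 (Asymptotics.isLittleO_iff.1 hd hε)
  set C₀ := |x₀ ^ r|
  set C₁ := |r * x₀ ^ (r - 1)|
  have hC₀ : 0 ≤ C₀ := abs_nonneg _
  have hC₁ : 0 ≤ C₁ := abs_nonneg _
  refine ⟨(1 + 2 * x₀ ^ 2 + C₀) / δ ^ 2 + 2 + C₁ / δ, by positivity, fun x => ?_⟩
  rcases lt_or_ge |x - x₀| δ with hx | hx
  · have := hδ' (y := x) (by rwa [Real.dist_eq])
    simp only [Real.norm_eq_abs, smul_eq_mul] at this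
    rw [mul_comm (r * _)]
    refine this.trans ?_
    have : 0 ≤ ((1 + 2 * x₀ ^ 2 + C₀) / δ ^ 2 + 2 + C₁ / δ) * (x - x₀) ^ 2 := by positivity
    linarith
  · have h1 : |x ^ r| ≤ 1 + x ^ 2 := by
      refine (Real.abs_rpow_le_abs_rpow x r).trans ?_
      rcases le_total |x| 1 with h | h
      · have := Real.rpow_le_one (abs_nonneg x) h (by linarith : 0 ≤ r)
        nlinarith [sq_nonneg x]
      · have := Real.rpow_le_rpow_of_exponent_le h hr2
        rw [Real.rpow_two, sq_abs] at this
        linarith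
    have h2 : x ^ 2 ≤ 2 * (x - x₀) ^ 2 + 2 * x₀ ^ 2 := by nlinarith [sq_nonneg (x - 2 * x₀)]
    have h3 : |x ^ r - x₀ ^ r - r * x₀ ^ (r - 1) * (x - x₀)| ≤
        |x ^ r| + C₀ + C₁ * |x - x₀| := by
      rw [← abs_mul]
      exact (abs_sub _ _).trans (add_le_add_left (abs_sub _ _) _)
    have h4 : 1 ≤ |x - x₀| / δ := by rwa [one_le_div hδ]
    have h5 : (1 + 2 * x₀ ^ 2 + C₀) ≤ (1 + 2 * x₀ ^ 2 + C₀) / δ ^ 2 * (x - x₀) ^ 2 := by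
      have : 1 ≤ (|x - x₀| / δ) ^ 2 := one_le_pow₀ h4
      calc _ ≤ (1 + 2 * x₀ ^ 2 + C₀) * (|x - x₀| / δ) ^ 2 :=
            le_mul_of_one_le_right (by positivity) this
        _ = _ := by rw [div_pow, sq_abs]; ring
    have h6 : C₁ * |x - x₀| ≤ C₁ / δ * (x - x₀) ^ 2 := by
      calc _ ≤ C₁ * |x - x₀| * (|x - x₀| / δ) := le_mul_of_one_le_right (by positivity) h4
        _ = _ := by rw [← sq_abs (x - x₀)]; ring
    have h7 : 0 ≤ ε * |x - x₀| := by positivity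
    linarith

section
variable {d : ℕ} {M : Matrix (Fin d) (Fin d) ℂ}

/-- First-order expansion of `Tr (N ^ r)` at a Hermitian matrix `M`. -/
theorem abs_trace_rpow_sub_taylor_le (hM : M.IsHermitian) {r : ℝ} (hr : 1 ≤ r) (hr2 : r ≤ 2)
    {ε : ℝ} (hε : 0 < ε) :
    ∃ K, 0 ≤ K ∧ ∀ N : Matrix (Fin d) (Fin d) ℂ, N.IsHermitian → ∀ h : ℝ, 0 < h →
      ((N - M) * (N - M)).trace.re ≤ h ^ 2 →
      |(cfc (fun s : ℝ => s ^ r) N).trace.re - (cfc (fun s : ℝ => s ^ r) M).trace.re -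
        r * (cfc (fun s : ℝ => s ^ (r - 1)) M * (N - M)).trace.re| ≤ ε * h + K * h ^ 2 := by
  obtain ⟨U, m, hU, -⟩ := hM.exists_diagonalizes
  -- The `d` rows of the overlap matrix contribute `d` shares of `ε * h`, and the quadratic term in
  -- `h1` contributes one more.
  have hε' : 0 < ε / (d + 1) := by positivity
  choose K hK0 hK using fun i => abs_rpow_sub_taylor_le hr hr2 (m i) hε'
  refine ⟨∑ i, K i, Finset.sum_nonneg fun i _ => hK0 i, fun N hN h hh hle => ?_⟩
  obtain ⟨V, l, hV, -⟩ := hN.exists_diagonalizes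
  have hS := mem_doublyStochastic_iff_sum.1 (hU.overlap_mem hV)
  -- Unit row and column sums turn single sums over eigenvalues into double sums weighted by `S`.
  -- Thus `Tr (N - M)²` and the trace remainder become `S`-weighted sums of `(l k - m i)²` and of
  -- scalar remainders.
  set S := overlap U V
  have hrow : ∀ f : Fin d → ℝ, ∑ i, f i = ∑ i, ∑ k, S i k * f i := fun f =>
    Finset.sum_congr rfl fun i _ => by rw [← Finset.sum_mul, hS.2.1 i, one_mul]
  have hcol : ∀ f : Fin d → ℝ, ∑ k, f k = ∑ i, ∑ k, S i k * f k := fun f => by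
    rw [Finset.sum_comm]
    exact Finset.sum_congr rfl fun k _ => by rw [← Finset.sum_mul, hS.2.2 k, one_mul]
  have hMN : ∀ f : ℝ → ℝ, (cfc f M * N).trace.re = ∑ i, ∑ k, S i k * (f (m i) * l k) := by
    intro f
    have := hU.trace_cfc_mul_cfc hV f id
    rw [cfc_id ℝ N hN.isSelfAdjoint] at this
    rw [this]
    exact Finset.sum_congr rfl fun i _ => Finset.sum_congr rfl fun k _ => mul_comm _ _
  have hself : ∀ {Z P : Matrix (Fin d) (Fin d) ℂ} {z : Fin d → ℝ}, Diagonalizes Z P z →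
      ∀ f : ℝ → ℝ, (cfc f Z * Z).trace.re = ∑ i, f (z i) * z i := by
    intro Z P z hZ f
    have := hZ.trace_cfc_mul_cfc hZ f id
    rw [cfc_id ℝ Z hZ.isHermitian.isSelfAdjoint, hZ.overlap_self] at this
    simpa [Matrix.one_apply] using this
  have hsq : ∑ i, ∑ k, S i k * (l k - m i) ^ 2 ≤ h ^ 2 := by
    refine le_trans (le_of_eq ?_) hle
    have e1 := hMN id
    have e2 := hself hU id
    have e3 := hself hV id
    rw [cfc_id ℝ M hM.isSelfAdjoint] at e1 e2
    rw [cfc_id ℝ N hN.isSelfAdjoint] at e3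
    rw [sub_mul, mul_sub, mul_sub, Matrix.trace_sub, Matrix.trace_sub, Matrix.trace_sub,
      Matrix.trace_mul_comm N M, Complex.sub_re, Complex.sub_re, Complex.sub_re, e1,
      e2.trans (hrow _), e3.trans (hcol _), ← Finset.sum_sub_distrib,
      ← Finset.sum_sub_distrib, ← Finset.sum_sub_distrib]
    refine Finset.sum_congr rfl fun i _ => ?_
    rw [← Finset.sum_sub_distrib, ← Finset.sum_sub_distrib, ← Finset.sum_sub_distrib]
    refine Finset.sum_congr rfl fun k _ => ?_
    simp only [id]
    ring
  have hrem : (cfc (fun s : ℝ => s ^ r) N).trace.re - (cfc (fun s : ℝ => s ^ r) M).trace.re -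
      r * (cfc (fun s : ℝ => s ^ (r - 1)) M * (N - M)).trace.re =
      ∑ i, ∑ k, S i k * (l k ^ r - m i ^ r - r * m i ^ (r - 1) * (l k - m i)) := by
    rw [mul_sub, Matrix.trace_sub, Complex.sub_re, hMN, (hself hU _).trans (hrow _),
      (hU.trace_cfc _).trans (hrow _), (hV.trace_cfc _).trans (hcol _),
      ← Finset.sum_sub_distrib, ← Finset.sum_sub_distrib, Finset.mul_sum,
      ← Finset.sum_sub_distrib]
    refine Finset.sum_congr rfl fun i _ => ?_
    rw [← Finset.sum_sub_distrib, ← Finset.sum_sub_distrib, Finset.mul_sum,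
      ← Finset.sum_sub_distrib]
    refine Finset.sum_congr rfl fun k _ => ?_
    ring
  have hterm : ∀ i k, |S i k * (l k ^ r - m i ^ r - r * m i ^ (r - 1) * (l k - m i))| ≤
      S i k * (ε / (d + 1) * h) +
        S i k * (l k - m i) ^ 2 * (ε / (d + 1) / h + ∑ i, K i) := by
    intro i k
    rw [abs_mul, abs_of_nonneg (hS.1 i k)]
    have h1 : |l k - m i| ≤ h + (l k - m i) ^ 2 / h := by
      rw [← sq_abs (l k - m i)]
      rw [← sub_le_iff_le_add', le_div_iff₀ hh]
      nlinarith [sq_nonneg (|l k - m i| - h), abs_nonneg (l k - m i),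
        sq_nonneg (|l k - m i|), sq_nonneg h]
    have h2 : K i ≤ ∑ i, K i := Finset.single_le_sum (fun i _ => hK0 i) (Finset.mem_univ i)
    calc S i k * |l k ^ r - m i ^ r - r * m i ^ (r - 1) * (l k - m i)|
        ≤ S i k * (ε / (d + 1) * (h + (l k - m i) ^ 2 / h) + (∑ i, K i) * (l k - m i) ^ 2) := by
          refine mul_le_mul_of_nonneg_left ((hK i (l k)).trans ?_) (hS.1 i k)
          gcongr
      _ = _ := by ring
  rw [hrem]
  calc |∑ i, ∑ k, S i k * (l k ^ r - m i ^ r - r * m i ^ (r - 1) * (l k - m i))|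
      ≤ ∑ i, ∑ k, |S i k * (l k ^ r - m i ^ r - r * m i ^ (r - 1) * (l k - m i))| :=
        (Finset.abs_sum_le_sum_abs _ _).trans
          (Finset.sum_le_sum fun i _ => Finset.abs_sum_le_sum_abs _ _)
    _ ≤ ∑ i, ∑ k, (S i k * (ε / (d + 1) * h) +
        S i k * (l k - m i) ^ 2 * (ε / (d + 1) / h + ∑ i, K i)) :=
        Finset.sum_le_sum fun i _ => Finset.sum_le_sum fun k _ => hterm i k
    _ = d * (ε / (d + 1) * h) +
        (∑ i, ∑ k, S i k * (l k - m i) ^ 2) * (ε / (d + 1) / h + ∑ i, K i) := by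
        simp_rw [Finset.sum_add_distrib]
        rw [← hrow]
        simp_rw [← Finset.sum_mul]
        rw [Finset.sum_const, Finset.card_univ, Fintype.card_fin, nsmul_eq_mul, mul_assoc]
    _ ≤ d * (ε / (d + 1) * h) + h ^ 2 * (ε / (d + 1) / h + ∑ i, K i) := by
        have : 0 ≤ ∑ i, K i := Finset.sum_nonneg fun i _ => hK0 i
        gcongr
    _ = ε * h + (∑ i, K i) * h ^ 2 := by
        field_simp
        ring

end

/-! ### Gradient on `ℝⁿ`, duality and conclusion -/

section
variable {n d : ℕ}

theorem trace_sum_smul_mul_self_le (A : Fin n → Matrix (Fin d) (Fin d) ℂ) :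
    ∃ C : ℝ, 0 < C ∧ ∀ u : EllOne n,
      ((∑ j, ((u j : ℝ) : ℂ) • A j) * ∑ j, ((u j : ℝ) : ℂ) • A j).trace.re ≤ (C * ‖u‖) ^ 2 := by
  set T := ∑ j, ∑ k, |(A j * A k).trace.re| with hT
  have hT0 : 0 ≤ T := Finset.sum_nonneg fun j _ => Finset.sum_nonneg fun k _ => abs_nonneg _
  -- Adding `1` makes the constant positive and ensures `T ≤ (T + 1) ^ 2`.
  refine ⟨T + 1, by positivity, fun u => ?_⟩
  have hu : ∀ j, |u j| ≤ ‖u‖ := fun j => PiLp.norm_apply_le u j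
  have h1 : ((∑ j, ((u j : ℝ) : ℂ) • A j) * ∑ j, ((u j : ℝ) : ℂ) • A j).trace.re =
      ∑ j, ∑ k, u j * u k * (A j * A k).trace.re := by
    rw [Finset.sum_mul, Matrix.trace_sum, Complex.re_sum]
    refine Finset.sum_congr rfl fun j _ => ?_
    rw [Finset.mul_sum, Matrix.trace_sum, Complex.re_sum]
    refine Finset.sum_congr rfl fun k _ => ?_
    rw [Matrix.smul_mul, Matrix.mul_smul, Matrix.trace_smul, Matrix.trace_smul, smul_eq_mul,
      smul_eq_mul, Complex.re_ofReal_mul, Complex.re_ofReal_mul, mul_assoc]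
  rw [h1]
  calc ∑ j, ∑ k, u j * u k * (A j * A k).trace.re
      ≤ ∑ j, ∑ k, ‖u‖ ^ 2 * |(A j * A k).trace.re| := by
        refine Finset.sum_le_sum fun j _ => Finset.sum_le_sum fun k _ => ?_
        refine (le_abs_self _).trans ?_
        rw [abs_mul, abs_mul, sq]
        gcongr
        exacts [hu j, hu k]
    _ = T * ‖u‖ ^ 2 := by simp_rw [← Finset.mul_sum]; rw [mul_comm]
    _ ≤ ((T + 1) * ‖u‖) ^ 2 := by
        rw [mul_pow]
        gcongr
        nlinarith

/-- The candidate gradient of `p ↦ Tr ((∑ p j A j) ^ r)`. -/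
noncomputable def traceRpowGrad (A : Fin n → Matrix (Fin d) (Fin d) ℂ) (r : ℝ) (p : EllOne n)
    (j : Fin n) : ℝ :=
  r * (cfc (fun s : ℝ => s ^ (r - 1)) (∑ j, ((p j : ℝ) : ℂ) • A j) * A j).trace.re

/-- The linear functional on `EllOne n` with coefficients `g`. -/
noncomputable def coeffFunctional (g : Fin n → ℝ) : EllOne n →L[ℝ] ℝ :=
  ∑ j, g j • PiLp.proj 1 (fun _ : Fin n => ℝ) j

theorem coeffFunctional_apply (g : Fin n → ℝ) (u : EllOne n) :
    coeffFunctional g u = ∑ j, g j * u j := by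
  simp [coeffFunctional]

theorem EllOne.norm_eq_sum (u : EllOne n) : ‖u‖ = ∑ j, |u j| := by
  simp [PiLp.norm_eq_of_L1]

theorem norm_coeffFunctional_sub_le {g g' : Fin n → ℝ} {C : ℝ} (hC : 0 ≤ C)
    (h : ∀ j, |g j - g' j| ≤ C) : ‖coeffFunctional g - coeffFunctional g'‖ ≤ C := by
  refine ContinuousLinearMap.opNorm_le_bound _ hC fun u => ?_
  rw [sub_apply, coeffFunctional_apply, coeffFunctional_apply,
    ← Finset.sum_sub_distrib, EllOne.norm_eq_sum, Finset.mul_sum]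
  refine (Finset.abs_sum_le_sum_abs _ _).trans (Finset.sum_le_sum fun j _ => ?_)
  rw [← sub_mul, abs_mul]
  exact mul_le_mul_of_nonneg_right (h j) (abs_nonneg _)

theorem hasFDerivAt_trace_rpow {A : Fin n → Matrix (Fin d) (Fin d) ℂ}
    (hA : ∀ j, (A j).IsHermitian) {r : ℝ} (hr : 1 ≤ r) (hr2 : r ≤ 2) (p : EllOne n) :
    HasFDerivAt (fun q : EllOne n =>
        (cfc (fun s : ℝ => s ^ r) (∑ j, ((q j : ℝ) : ℂ) • A j)).trace.re)
      (coeffFunctional (traceRpowGrad A r p)) p := by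
  obtain ⟨C, hC, hCle⟩ := trace_sum_smul_mul_self_le A
  refine .of_isLittleO (Asymptotics.isLittleO_iff.2 fun c hc => ?_)
  obtain ⟨K, hK0, hK⟩ := abs_trace_rpow_sub_taylor_le
    (isHermitian_sum_smul hA fun j => p j) hr hr2 (ε := c / (2 * C)) (by positivity)
  -- The linear and quadratic error terms each receive `c / 2`; the `+ 1` covers `K = 0`.
  have hδ : 0 < c / (2 * (K * C ^ 2 + 1)) := by positivity
  refine Metric.eventually_nhds_iff.2 ⟨_, hδ, fun q hq => ?_⟩
  rw [dist_eq_norm] at hq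
  rcases eq_or_ne q p with rfl | hne
  · simp
  · have hpos : 0 < ‖q - p‖ := norm_pos_iff.2 (sub_ne_zero.2 hne)
    have hdiff : (∑ j, ((q j : ℝ) : ℂ) • A j) - ∑ j, ((p j : ℝ) : ℂ) • A j =
        ∑ j, (((q - p) j : ℝ) : ℂ) • A j := by
      rw [← Finset.sum_sub_distrib]
      refine Finset.sum_congr rfl fun j _ => ?_
      rw [← sub_smul, PiLp.sub_apply, Complex.ofReal_sub]
    have h1 := hK _ (isHermitian_sum_smul hA fun j => q j) (C * ‖q - p‖) (by positivity)
      (by rw [hdiff]; exact hCle _)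
    have h2 : coeffFunctional (traceRpowGrad A r p) (q - p) =
        r * (cfc (fun s : ℝ => s ^ (r - 1)) (∑ j, ((p j : ℝ) : ℂ) • A j) *
          ∑ j, (((q - p) j : ℝ) : ℂ) • A j).trace.re := by
      rw [coeffFunctional_apply, Finset.mul_sum, Matrix.trace_sum, Complex.re_sum, Finset.mul_sum]
      refine Finset.sum_congr rfl fun j _ => ?_
      rw [Matrix.mul_smul, Matrix.trace_smul, smul_eq_mul, Complex.re_ofReal_mul, traceRpowGrad]
      ring
    rw [Real.norm_eq_abs, h2, ← hdiff]
    refine h1.trans ?_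
    have h3 : K * C ^ 2 * ‖q - p‖ ≤ c / 2 := by
      rw [lt_div_iff₀ (by positivity)] at hq
      nlinarith [mul_nonneg hK0 (sq_nonneg C)]
    calc c / (2 * C) * (C * ‖q - p‖) + K * (C * ‖q - p‖) ^ 2
        = c / 2 * ‖q - p‖ + K * C ^ 2 * ‖q - p‖ * ‖q - p‖ := by field_simp
      _ ≤ c / 2 * ‖q - p‖ + c / 2 * ‖q - p‖ := by gcongr
      _ = c * ‖q - p‖ := by ring

theorem abs_traceRpowGrad_sub_le {A : Fin n → Matrix (Fin d) (Fin d) ℂ}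
    (hA : ∀ j, (A j).PosSemidef) {r : ℝ} (hr : 1 ≤ r) (hr2 : r ≤ 2)
    (hA1 : ∀ j, (cfc (fun s : ℝ => s ^ r) (A j)).trace.re = 1) {p q : EllOne n}
    (hp : ∀ j, 0 ≤ p j) (hq : ∀ j, 0 ≤ q j) (i : Fin n) :
    |traceRpowGrad A r p i - traceRpowGrad A r q i| ≤ r * (∑ j, |p j - q j|) ^ (r - 1) := by
  unfold traceRpowGrad
  rw [← mul_sub, abs_mul, abs_of_nonneg (by linarith : 0 ≤ r)]
  refine mul_le_mul_of_nonneg_left (abs_le'.2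
    ⟨trace_rpow_sub_mul_le_rpow hA hr hr2 hA1 hp hq i, ?_⟩) (by linarith)
  rw [neg_sub]
  simp_rw [abs_sub_comm (p _)]
  exact trace_rpow_sub_mul_le_rpow hA hr hr2 hA1 hq hp i

theorem convex_probSimplex : Convex ℝ (probSimplex n) := by
  rintro x ⟨hx0, hx1⟩ y ⟨hy0, hy1⟩ a b ha hb hab
  refine ⟨fun j => ?_, ?_⟩
  · simpa using add_nonneg (mul_nonneg ha (hx0 j)) (mul_nonneg hb (hy0 j))
  · simp [Finset.sum_add_distrib, ← Finset.mul_sum, hx1, hy1, hab]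

theorem IsQuantumState.posSemidef_hermitianPow {W : Matrix (Fin d) (Fin d) ℂ}
    (hW : IsQuantumState W) (α : ℝ) : (hermitianPow W α).PosSemidef := by
  obtain ⟨U, w, hU, -⟩ := hW.1.isHermitian.exists_diagonalizes
  exact hU.posSemidef_cfc fun i => Real.rpow_nonneg (hU.nonneg hW.1 i) α

theorem IsQuantumState.trace_hermitianPow_rpow {W : Matrix (Fin d) (Fin d) ℂ}
    (hW : IsQuantumState W) {α : ℝ} (hα : 0 < α) :
    (cfc (fun s : ℝ => s ^ (1 / α)) (hermitianPow W α)).trace.re = 1 := by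
  obtain ⟨U, w, hU, -⟩ := hW.1.isHermitian.exists_diagonalizes
  -- Finiteness of the spectrum makes the continuity conditions for composing functional calculi
  -- automatic.
  have hfin : (spectrum ℝ W).Finite := Matrix.finite_real_spectrum
  rw [hermitianPow, ← cfc_comp' (fun s : ℝ => s ^ (1 / α)) (fun s : ℝ => s ^ α) W
    ((hfin.image _).continuousOn _) (hfin.continuousOn _) hU.isHermitian.isSelfAdjoint,
    hU.trace_cfc]
  have h1 := hU.trace_cfc id
  rw [cfc_id ℝ W hU.isHermitian.isSelfAdjoint, hW.2, Complex.one_re] at h1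
  refine Eq.trans (Finset.sum_congr rfl fun i _ => ?_) h1.symm
  rw [← Real.rpow_mul (hU.nonneg hW.1 i), mul_one_div_cancel hα.ne', Real.rpow_one, id]

end

theorem mainTheorem2 (n d : ℕ) (W : Fin n → Matrix (Fin d) (Fin d) ℂ)
    (hW : ∀ j, IsQuantumState (W j)) (α : ℝ) (hα : α ∈ Set.Icc (1 / 2 : ℝ) 1) :
    HolderSmoothOn (expRenyi W α) (probSimplex n) ((1 - α) / α) (1 / α) ∧
    ∀ p₁ ∈ probSimplex n, ∀ p₂ ∈ probSimplex n,
      ‖gradVec (expRenyi W α) p₁ - gradVec (expRenyi W α) p₂‖ ≤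
        1 / α * (∑ j, |p₁ j - p₂ j|) ^ (1 / α - 1) := by
  obtain ⟨hα1, hα2⟩ := hα
  have hα0 : 0 < α := by linarith
  set A : Fin n → Matrix (Fin d) (Fin d) ℂ := fun j => hermitianPow (W j) α
  have hA : ∀ j, (A j).PosSemidef := fun j => (hW j).posSemidef_hermitianPow α
  have hA1 : ∀ j, (cfc (fun s : ℝ => s ^ (1 / α)) (A j)).trace.re = 1 :=
    fun j => (hW j).trace_hermitianPow_rpow hα0
  have hr : 1 ≤ 1 / α := by rwa [le_div_iff₀ hα0, one_mul]
  have hr2 : 1 / α ≤ 2 := by rw [div_le_iff₀ hα0]; linarith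
  have hν : (1 - α) / α = 1 / α - 1 := by field_simp
  have hderiv : ∀ p, HasFDerivAt (expRenyi W α) (coeffFunctional (traceRpowGrad A (1 / α) p)) p :=
    hasFDerivAt_trace_rpow (fun j => (hA j).isHermitian) hr hr2
  have hgrad : ∀ p ∈ probSimplex n, ∀ q ∈ probSimplex n, ∀ i,
      |traceRpowGrad A (1 / α) p i - traceRpowGrad A (1 / α) q i| ≤
        1 / α * (∑ j, |p j - q j|) ^ (1 / α - 1) :=
    fun p hp q hq => abs_traceRpowGrad_sub_le hA hr hr2 hA1 hp.1 hq.1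
  have hnonneg : ∀ p q : EllOne n, 0 ≤ 1 / α * (∑ j, |p j - q j|) ^ (1 / α - 1) := fun p q =>
    mul_nonneg (by positivity)
      (Real.rpow_nonneg (Finset.sum_nonneg fun j _ => abs_nonneg _) _)
  refine ⟨⟨convex_probSimplex, by rw [hν]; linarith, by rw [hν]; linarith, by positivity,
    fun p _ => (hderiv p).differentiableAt, fun p hp q hq => ?_⟩, fun p hp q hq => ?_⟩
  · rw [(hderiv p).fderiv, (hderiv q).fderiv, hν, EllOne.norm_eq_sum]
    exact norm_coeffFunctional_sub_le (hnonneg p q) (hgrad p hp q hq)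
  · refine (pi_norm_le_iff_of_nonneg (hnonneg p q)).2 fun i => ?_
    rw [Pi.sub_apply, gradVec, gradVec, (hderiv p).fderiv, (hderiv q).fderiv,
      coeffFunctional_apply, coeffFunctional_apply]
    simpa [Pi.single_apply] using hgrad p hp q hq i
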